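/- Jobs $1,\dots,n$ with unknown processing times $p_1,\dots,p_n>0$ (in arbitrary order) are scheduled preemptively on one machine of unit speed, all being available at time $0$. If $e_j(t)$ is the amount of processing that job $j$ has received until time $t$, then its completion time is $C_j=\min\{t : e_j(t)\ge p_j\}$, and $\mathrm{ALG}=\sum_j C_j$. Let $\mathrm{OPT}(p)$ be the least total completion time of any preemptive schedule for $p$; it equals $\sum_{i=1}^n (n-i+1)\,p_{(i)}$, where $p_{(1)}\le\dots\le p_{(n)}$ are the processing times in increasing order. Let $g\ge 1$ be an integer. Each job $j$ has, independently of the others, a Poisson stochastic progress bar of granularity $g$: if $\tilde\beta_j^{(1)}\le\dots\le\tilde\beta_j^{(g)}$ are the first $g$ points of a Poisson process of rate $g$ on $\mathbb R_{+}$ (that is, $\tilde\beta_j^{(1)}$ and the successive differences are independent exponential variables with parameter $g$), $\beta_j^{(h)}=\min(1,\tilde\beta_j^{(h)})$ for $1\le h\le g$ and $\beta_j^{(g+1)}=1$, then $$\varphi_j(x)=\frac1{g+1}\sum_{h=1}^{g+1}\mathbb 1\bigl(x\ge\beta_j^{(h)}\bigr).$$ After job $j$ has received $e$ units of processing, the displayed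 progress of $j$ is $X_j(e)=\varphi_j(e/p_j)$. A scheduling algorithm, deterministic or randomized, knows $n$ and $g$ but not $p$. A randomized algorithm uses a random seed that is independent of the progress bars. The algorithm is online: given the seed, its schedule until time $t$ depends only on the displayed progress seen until then, i.e. on $X_j(e)$ for $0\le e\le e_j(t)$ and $1\le j\le n$. Its expected competitive ratio is $$\sup_{n\ge1,\;p\in(0,\infty)^n}\frac{\mathbb E[\mathrm{ALG}(p)]}{\mathrm{OPT}(p)},$$ where the expectation is over the progress bars and the seed. Then every scheduling algorithm, deterministic or randomized, has expected competitive ratio at least $1+\frac1{36}\,g^{-1/3}$. -/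

import Mathlib

open MeasureTheory ProbabilityTheory
open scoped ENNReal

noncomputable section

namespace ProgressBar

/-- A preemptive single-machine schedule of `n` jobs, given by the elapsed times: `S.elapsed t j` is
the amount of processing that job `j` has received until time `t ≥ 0`. During `[s, t]` the jobs
together receive at most `t - s` units of processing; the machine may be shared, preempt jobs
arbitrarily often, and idle. -/
structure Schedule (n : ℕ) where
  elapsed : ℝ → Fin n → ℝ
  elapsed_zero : ∀ j, elapsed 0 j = 0
  mono : ∀ s t j, 0 ≤ s → s ≤ t → elapsed s j ≤ elapsed t j
  speed : ∀ s t, 0 ≤ s → s ≤ t → ∑ j, (elapsed t j - elapsed s j) ≤ t - s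

/-- The completion time of job `j` when the processing times are `p`: the earliest time at which the
elapsed time of `j` is at least `p j` (`∞` if there is none). -/
def Schedule.completionTime {n : ℕ} (S : Schedule n) (p : Fin n → ℝ) (j : Fin n) : ℝ≥0∞ :=
  ⨅ (t : ℝ) (_ : 0 ≤ t ∧ p j ≤ S.elapsed t j), ENNReal.ofReal t

/-- The total completion time of a schedule. -/
def Schedule.totalCompletionTime {n : ℕ} (S : Schedule n) (p : Fin n → ℝ) : ℝ≥0∞ :=
  ∑ j, S.completionTime p j

/-- The optimal objective value: the least total completion time of a schedule. -/
def opt {n : ℕ} (p : Fin n → ℝ) : ℝ≥0∞ :=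
  ⨅ S : Schedule n, S.totalCompletionTime p

/-- The first `g` points of a point process on the positive half-line with successive gaps `w`. -/
def jumpPoint {g : ℕ} (w : Fin g → ℝ) (h : Fin g) : ℝ :=
  ∑ i ∈ Finset.Iic h, w i

/-- The progress bar of granularity `g` with gaps `w`, as a function of the actual progress `x`:
it climbs one of its `g + 1` steps at each of the points `min 1 (jumpPoint w h)`, `h : Fin g`,
and at `1`. -/
def bar {g : ℕ} (w : Fin g → ℝ) (x : ℝ) : ℝ :=
  1 / ((g : ℝ) + 1) *
    ((∑ h, if min 1 (jumpPoint w h) ≤ x then (1 : ℝ) else 0) + (if 1 ≤ x then 1 else 0))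

/-- What a scheduler can see: the displayed progress of job `j` after it has received `e` units of
processing. It equals `1` exactly from the completion of the job on. -/
def display {n g : ℕ} (p : Fin n → ℝ) (w : Fin n → Fin g → ℝ) (j : Fin n) (e : ℝ) : ℝ :=
  bar (w j) (e / p j)

/-- The law of the gaps of the `n` progress bars: all gaps are independent and exponentially
distributed with parameter `g`, so that the points of each bar are the first `g` points of
a Poisson process of rate `g`, independently for distinct jobs. -/
def barLaw (n g : ℕ) : Measure (Fin n → Fin g → ℝ) :=
  Measure.pi fun _ => Measure.pi fun _ => expMeasure (g : ℝ)

/-- The families of displayed progress functions that can occur for `n` jobs. -/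
def displays (n g : ℕ) : Set (Fin n → ℝ → ℝ) :=
  {X | ∃ (p : Fin n → ℝ) (w : Fin n → Fin g → ℝ),
    (∀ j, 0 < p j) ∧ (∀ j h, 0 < w j h) ∧ X = display p w}

/-- A scheduling algorithm for progress bars of granularity `g` with random seeds in `U`
(a deterministic algorithm is one that ignores its seed, for example with `U = Unit`).
It does not know the processing times: it produces a schedule from the number of jobs, the seed
and the displayed progress, and it is online: the schedule until time `t` depends only on
what has been displayed until then, that is, for every job `j`, on the displayed progress
of `j` for the elapsed times in `[0, elapsed t j]`. -/
structure Algorithm (g : ℕ) (U : Type*) [MeasurableSpace U] where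
  run : (n : ℕ) → U → (Fin n → ℝ → ℝ) → Schedule n
  online : ∀ (n : ℕ) (u : U), ∀ X ∈ displays n g, ∀ Y ∈ displays n g, ∀ t : ℝ, 0 ≤ t →
    (∀ j, ∀ e ∈ Set.Icc 0 ((run n u X).elapsed t j), X j e = Y j e) →
    (run n u X).elapsed t = (run n u Y).elapsed t
  measurable_run : ∀ (n : ℕ) (p : Fin n → ℝ), (∀ j, 0 < p j) → ∀ (t : ℝ) (j : Fin n), 0 ≤ t →
    Measurable fun z : U × (Fin n → Fin g → ℝ) => (run n z.1 (display p z.2)).elapsed t j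

/-- The expected total completion time of the algorithm on the jobs with processing times `p`, over
the seed of the algorithm (with law `ν`) and the independent progress bars. -/
def Algorithm.expectedCost {g : ℕ} {U : Type*} [MeasurableSpace U] (A : Algorithm g U)
    (ν : Measure U) {n : ℕ} (p : Fin n → ℝ) : ℝ≥0∞ :=
  ∫⁻ z, (A.run n z.1 (display p z.2)).totalCompletionTime p ∂(ν.prod (barLaw n g))

/-- The expected competitive ratio: the supremum, over all instances, of the expected
total completion time divided by the optimal objective value. The processing times of an
instance are listed in an arbitrary order. -/
def Algorithm.competitiveRatio {g : ℕ} {U : Type*} [MeasurableSpace U] (A : Algorithm g U)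
    (ν : Measure U) : ℝ≥0∞ :=
  ⨆ (n : ℕ) (p : Fin n → ℝ) (_ : 0 < n ∧ ∀ j, 0 < p j), A.expectedCost ν p / opt p

end ProgressBar

end

/-!
The adversary uses two jobs. If both have length `1`, then with probability at least `1 / 2` some
fixed job `i` is the first to receive `ε` units of processing. Lengthen this job to `1 + ε`: if it
still is the first to receive `ε` units, then either the short job is delayed by `ε` or it is
completed last, and the total completion time is at least `3 + 2 * ε`, while the optimum is at most
`3 + ε`. Whether `i` comes first depends only on what is
displayed of each job during its first `ε` units, and within that window the longer job looks like
a unit job whose Poisson process has rate `g / (1 + ε)` instead of `g`. The second moment of the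
likelihood ratio of these two processes, observed until `ε`, is at most
`exp (g * ε ^ 3 / (1 + ε))`, so for `ε` of order `g ^ (-1 / 3)` job `i` still comes first with
probability bounded away from zero.

The second moment is bounded gap by gap: the first gap is compared through the likelihood ratio of
an exponential variable stopped at the end of the window, and whatever it leaves of the window
remains for the other gaps.
-/

namespace ProgressBar

section Integration

variable {α : Type*} [MeasurableSpace α]

theorem sq_lintegral_le_of_sq_le_mul {μ : Measure α} {f V G : α → ℝ≥0∞} (hV : AEMeasurable V μ)
    (hG : AEMeasurable G μ) (h : ∀ᵐ a ∂μ, f a ^ 2 ≤ V a * G a) :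
    (∫⁻ a, f a ∂μ) ^ 2 ≤ (∫⁻ a, V a ∂μ) * ∫⁻ a, G a ∂μ := by
  have sq_sqrt (y : ℝ≥0∞) : (y ^ (1 / 2 : ℝ)) ^ 2 = y := by
    rw [← ENNReal.rpow_natCast, ← ENNReal.rpow_mul]
    norm_num
  have hf : ∀ᵐ a ∂μ, f a ≤ V a ^ (1 / 2 : ℝ) * G a ^ (1 / 2 : ℝ) := by
    filter_upwards [h] with a ha
    rw [← ENNReal.pow_le_pow_left_iff two_ne_zero, mul_pow, sq_sqrt, sq_sqrt]
    exact ha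
  calc (∫⁻ a, f a ∂μ) ^ 2
      ≤ ((∫⁻ a, V a ∂μ) ^ (1 / 2 : ℝ) * (∫⁻ a, G a ∂μ) ^ (1 / 2 : ℝ)) ^ 2 := by
        gcongr
        exact (lintegral_mono_ae hf).trans <| ENNReal.lintegral_mul_norm_pow_le hV hG
          (by norm_num) (by norm_num) (by norm_num)
    _ = (∫⁻ a, V a ∂μ) * ∫⁻ a, G a ∂μ := by rw [mul_pow, sq_sqrt, sq_sqrt]

theorem exists_inv_card_le_measureReal {ι : Type*} [Fintype ι] (μ : Measure α)
    [IsProbabilityMeasure μ] {E : ι → Set α} (hE : ⋃ i, E i = Set.univ) :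
    ∃ i, (Fintype.card ι : ℝ)⁻¹ ≤ μ.real (E i) := by
  have hsum : 1 ≤ ∑ i, μ.real (E i) := by
    rw [← probReal_univ (μ := μ), ← hE]
    exact measureReal_iUnion_fintype_le E
  have hι : (Finset.univ : Finset ι).Nonempty := by
    by_contra! h
    norm_num [h] at hsum
  obtain ⟨i, -, hi⟩ : ∃ i ∈ Finset.univ, (Fintype.card ι : ℝ)⁻¹ ≤ μ.real (E i) := by
    refine Finset.exists_le_of_sum_le hι (le_trans ?_ hsum)
    simpa using mul_inv_le_one
  exact ⟨i, hi⟩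

theorem ae_pi_forall {ι : Type*} [Fintype ι] {X : ι → Type*} [∀ i, MeasurableSpace (X i)]
    {μ : ∀ i, Measure (X i)} [∀ i, SigmaFinite (μ i)] {P : ∀ i, X i → Prop}
    (h : ∀ i, ∀ᵐ x ∂μ i, P i x) : ∀ᵐ x ∂Measure.pi μ, ∀ i, P i (x i) :=
  ae_all_iff.2 fun i => (Measure.quasiMeasurePreserving_eval μ i).ae (h i)

variable {n : ℕ} {X : Fin (n + 1) → Type*} [∀ i, MeasurableSpace (X i)]
  (μ : ∀ i, Measure (X i)) [∀ i, SigmaFinite (μ i)] (i : Fin (n + 1))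

theorem measurePreserving_insertNth :
    MeasurePreserving (fun z : X i × (∀ j, X (i.succAbove j)) => i.insertNth z.1 z.2)
      ((μ i).prod (Measure.pi fun j => μ (i.succAbove j))) (Measure.pi μ) :=
  (measurePreserving_piFinSuccAbove μ i).symm

theorem lintegral_pi_insertNth {f : (∀ i, X i) → ℝ≥0∞} (hf : Measurable f) :
    ∫⁻ w, f w ∂Measure.pi μ =
      ∫⁻ s, ∫⁻ v, f (i.insertNth s v) ∂(Measure.pi fun j => μ (i.succAbove j)) ∂μ i := by
  have hins := measurePreserving_insertNth μ i
  rw [← hins.lintegral_comp hf]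
  exact lintegral_prod _ (hf.comp hins.measurable).aemeasurable

theorem measurePreserving_prodMk_insertNth (ν : Measure α) [SFinite ν] :
    MeasurePreserving
      (fun z : X i × α × (∀ j, X (i.succAbove j)) => (z.2.1, i.insertNth z.1 z.2.2))
      ((μ i).prod (ν.prod (Measure.pi fun j => μ (i.succAbove j)))) (ν.prod (Measure.pi μ)) := by
  have hassoc := (measurePreserving_prodAssoc (μ i) ν (Measure.pi fun j => μ (i.succAbove j))).symm
  have hswap := (Measure.measurePreserving_swap (μ := μ i) (ν := ν)).prod
    (MeasurePreserving.id (Measure.pi fun j => μ (i.succAbove j)))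
  have hassoc' := measurePreserving_prodAssoc ν (μ i) (Measure.pi fun j => μ (i.succAbove j))
  exact ((MeasurePreserving.id ν).prod (measurePreserving_insertNth μ i)).comp
    (hassoc'.comp (hswap.comp hassoc))

end Integration

section Exponential

variable {a b r x : ℝ}

theorem expMeasure_real_Ioi (hr : 0 < r) (hx : 0 ≤ x) :
    (expMeasure r).real (Set.Ioi x) = Real.exp (-(r * x)) := by
  have := isProbabilityMeasure_expMeasure hr
  rw [← Set.compl_Iic, probReal_compl_eq_one_sub measurableSet_Iic, ← cdf_eq_real,
    cdf_expMeasure_eq hr, if_pos hx, sub_sub_cancel]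

theorem ae_pos_expMeasure (hr : 0 < r) : ∀ᵐ s ∂expMeasure r, 0 < s := by
  have := isProbabilityMeasure_expMeasure hr
  refine (mem_ae_iff_prob_eq_one measurableSet_Ioi).2 ?_
  rw [← ofReal_measureReal, expMeasure_real_Ioi hr le_rfl]
  simp

theorem map_mul_expMeasure {q : ℝ} (hr : 0 < r) (hq : 0 < q) :
    (expMeasure r).map (fun s => q * s) = expMeasure (r / q) := by
  have hmul : Measurable fun s : ℝ => q * s := measurable_const_mul q
  have := isProbabilityMeasure_expMeasure hr
  have := isProbabilityMeasure_expMeasure (div_pos hr hq)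
  have := Measure.isProbabilityMeasure_map (μ := expMeasure r) hmul.aemeasurable
  refine Measure.eq_of_cdf _ _ (StieltjesFunction.ext fun x => ?_)
  rw [cdf_eq_real, map_measureReal_apply hmul measurableSet_Iic, Set.preimage_const_mul_Iic₀ x hq,
    ← cdf_eq_real, cdf_expMeasure_eq hr, cdf_expMeasure_eq (div_pos hr hq)]
  simp only [le_div_iff₀ hq, zero_mul]
  ring_nf

theorem measurePreserving_smul_pi_expMeasure {ι : Type*} [Fintype ι] {q : ℝ} (hr : 0 < r)
    (hq : 0 < q) :
    MeasurePreserving (fun s : ι → ℝ => q • s) (Measure.pi fun _ => expMeasure r)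
      (Measure.pi fun _ => expMeasure (r / q)) := by
  have := isProbabilityMeasure_expMeasure hr
  have := isProbabilityMeasure_expMeasure (div_pos hr hq)
  exact measurePreserving_pi _ _ fun _ => ⟨measurable_const_mul q, map_mul_expMeasure hr hq⟩

theorem setLIntegral_expMeasure {S : Set ℝ} (hS : MeasurableSet S) {f : ℝ → ℝ≥0∞}
    (hf : Measurable f) :
    ∫⁻ s in S, f s ∂expMeasure r = ∫⁻ s in S, exponentialPDF r s * f s :=
  setLIntegral_withDensity_eq_setLIntegral_mul _
    (measurable_exponentialPDFReal r).ennreal_ofReal hf hS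

/-- The likelihood ratio of the exponential law of rate `b` against that of rate `a`, when the
variable is observed only until time `x`: for `s > x` it compares the probabilities of the event
`(x, ∞)` instead of the densities at `s`. -/
noncomputable def stoppedRatio (a b x s : ℝ) : ℝ :=
  (if s ≤ x then b / a else 1) * Real.exp (-((b - a) * min s x))

theorem stoppedRatio_nonneg (ha : 0 ≤ a) (hb : 0 ≤ b) (s : ℝ) : 0 ≤ stoppedRatio a b x s := by
  unfold stoppedRatio
  positivity

theorem measurable_stoppedRatio : Measurable (stoppedRatio a b x) :=
  (Measurable.ite measurableSet_Iic measurable_const measurable_const).mul (by fun_prop)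

theorem exponentialPDF_mul_stoppedRatio (ha : 0 < a) (hb : 0 < b) {s : ℝ} (hs : s ≤ x) :
    exponentialPDF a s * ENNReal.ofReal (stoppedRatio a b x s) = exponentialPDF b s := by
  rcases lt_or_ge s 0 with hs0 | hs0
  · rw [exponentialPDF_of_neg hs0, exponentialPDF_of_neg hs0, zero_mul]
  · rw [exponentialPDF_of_nonneg hs0, exponentialPDF_of_nonneg hs0,
      ← ENNReal.ofReal_mul (by positivity), stoppedRatio, if_pos hs, min_eq_left hs,
      show -(b * s) = -(a * s) + -((b - a) * s) by ring, Real.exp_add]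
    congr 1
    field_simp

theorem lintegral_stoppedRatio_mul (ha : 0 < a) (hb : 0 < b) (hx : 0 ≤ x) {F : ℝ → ℝ≥0∞}
    (hF : Measurable F) {K : ℝ≥0∞} (hK : ∀ s, x < s → F s = K) :
    ∫⁻ s, ENNReal.ofReal (stoppedRatio a b x s) * F s ∂expMeasure a =
      ∫⁻ s, F s ∂expMeasure b := by
  have := isProbabilityMeasure_expMeasure ha
  have := isProbabilityMeasure_expMeasure hb
  have hratioF : Measurable fun s => ENNReal.ofReal (stoppedRatio a b x s) * F s :=
    measurable_stoppedRatio.ennreal_ofReal.mul hF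
  rw [← lintegral_add_compl _ (measurableSet_Iic (a := x)),
    ← lintegral_add_compl F (measurableSet_Iic (a := x)), Set.compl_Iic]
  congr 1
  · rw [setLIntegral_expMeasure measurableSet_Iic hratioF,
      setLIntegral_expMeasure measurableSet_Iic hF]
    refine setLIntegral_congr_fun measurableSet_Iic fun s hs => ?_
    rw [← mul_assoc, exponentialPDF_mul_stoppedRatio ha hb hs]
  · have hleft : ∀ s ∈ Set.Ioi x, ENNReal.ofReal (stoppedRatio a b x s) * F s =
        ENNReal.ofReal (Real.exp (-((b - a) * x))) * K := fun s hs => by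
      rw [hK s hs, stoppedRatio, if_neg (not_le.2 hs), min_eq_right (le_of_lt hs), one_mul]
    rw [setLIntegral_congr_fun measurableSet_Ioi hleft, setLIntegral_congr_fun measurableSet_Ioi hK,
      setLIntegral_const, setLIntegral_const, ← ofReal_measureReal, ← ofReal_measureReal,
      expMeasure_real_Ioi ha hx, expMeasure_real_Ioi hb hx, mul_right_comm,
      ← ENNReal.ofReal_mul (Real.exp_pos _).le, ← Real.exp_add, mul_comm K]
    ring_nf

theorem lintegral_stoppedRatio (ha : 0 < a) (hb : 0 < b) (hx : 0 ≤ x) :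
    ∫⁻ s, ENNReal.ofReal (stoppedRatio a b x s) ∂expMeasure a = 1 := by
  have := isProbabilityMeasure_expMeasure hb
  simpa using lintegral_stoppedRatio_mul ha hb hx (F := 1) measurable_one fun _ _ => rfl

/- With `c = (b - a) ^ 2 / a`, the factor `exp (c * (x - min s x))` is the cost of the window left
after the gap `s`; since the right-hand side is again `exp (c * x)` times a likelihood ratio, which
has mean `1`, the cost of the whole window is `exp (c * x)` whatever the number of gaps. -/
theorem stoppedRatio_sq_mul_exp (ha : a ≠ 0) (s : ℝ) :
    stoppedRatio a b x s ^ 2 * Real.exp ((b - a) ^ 2 / a * (x - min s x)) =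
      Real.exp ((b - a) ^ 2 / a * x) * stoppedRatio a (b ^ 2 / a) x s := by
  have hexp : Real.exp (-((b - a) * min s x)) ^ 2 *
      Real.exp ((b - a) ^ 2 / a * (x - min s x)) =
      Real.exp ((b - a) ^ 2 / a * x) * Real.exp (-((b ^ 2 / a - a) * min s x)) := by
    rw [← Real.exp_nat_mul, ← Real.exp_add, ← Real.exp_add]
    congr 1
    field_simp
    push_cast
    ring
  have hfactor : (if s ≤ x then b / a else 1) ^ 2 = if s ≤ x then b ^ 2 / a / a else 1 := by
    split_ifs
    · field_simp
    · simp
  rw [stoppedRatio, stoppedRatio, mul_pow, mul_assoc, hexp, hfactor]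
  ring

theorem sq_lintegral_expMeasure_le (ha : 0 < a) (hb : 0 < b) (hx : 0 ≤ x) {F G : ℝ → ℝ≥0∞}
    (hF : Measurable F) (hG : Measurable G) {K : ℝ≥0∞} (hK : ∀ s, x < s → F s = K)
    (hFG : ∀ s, 0 < s →
      F s ^ 2 ≤ ENNReal.ofReal (Real.exp ((b - a) ^ 2 / a * (x - min s x))) * G s) :
    (∫⁻ s, F s ∂expMeasure b) ^ 2 ≤
      ENNReal.ofReal (Real.exp ((b - a) ^ 2 / a * x)) * ∫⁻ s, G s ∂expMeasure a := by
  set C := ENNReal.ofReal (Real.exp ((b - a) ^ 2 / a * x))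
  set ratio := fun c s => ENNReal.ofReal (stoppedRatio a c x s)
  have hratio : Measurable (ratio (b ^ 2 / a)) := measurable_stoppedRatio.ennreal_ofReal
  have hsq (s : ℝ) (hs : 0 < s) : (ratio b s * F s) ^ 2 ≤ C * ratio (b ^ 2 / a) s * G s :=
    calc (ratio b s * F s) ^ 2
        ≤ ratio b s ^ 2 *
            (ENNReal.ofReal (Real.exp ((b - a) ^ 2 / a * (x - min s x))) * G s) := by
          rw [mul_pow]
          gcongr
          exact hFG s hs
      _ = C * ratio (b ^ 2 / a) s * G s := by
          rw [← mul_assoc, ← ENNReal.ofReal_pow (stoppedRatio_nonneg ha.le hb.le s),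
            ← ENNReal.ofReal_mul (by positivity), stoppedRatio_sq_mul_exp ha.ne',
            ENNReal.ofReal_mul (by positivity)]
  calc (∫⁻ s, F s ∂expMeasure b) ^ 2
      = (∫⁻ s, ratio b s * F s ∂expMeasure a) ^ 2 := by
        rw [lintegral_stoppedRatio_mul ha hb hx hF hK]
    _ ≤ (∫⁻ s, C * ratio (b ^ 2 / a) s ∂expMeasure a) * ∫⁻ s, G s ∂expMeasure a :=
        sq_lintegral_le_of_sq_le_mul (hratio.const_mul C).aemeasurable hG.aemeasurable
          ((ae_pos_expMeasure ha).mono hsq)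
    _ = C * ∫⁻ s, G s ∂expMeasure a := by
        rw [lintegral_const_mul _ hratio, lintegral_stoppedRatio ha (by positivity) hx, mul_one]

end Exponential

section PointProcess

variable {k : ℕ} {x s : ℝ} {v v' : Fin k → ℝ}

theorem jumpPoint_cons_zero (s : ℝ) (v : Fin k → ℝ) :
    jumpPoint (Fin.cons s v : Fin (k + 1) → ℝ) 0 = s := by
  rw [jumpPoint, ← bot_eq_zero, Finset.Iic_bot, Finset.sum_singleton]
  rfl

theorem jumpPoint_cons_succ (s : ℝ) (v : Fin k → ℝ) (h : Fin k) :
    jumpPoint (Fin.cons s v : Fin (k + 1) → ℝ) h.succ = s + jumpPoint v h := by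
  have jumpPoint_eq_sum_ite {m : ℕ} (w : Fin m → ℝ) (h : Fin m) :
      jumpPoint w h = ∑ i, if i ≤ h then w i else 0 := by
    rw [jumpPoint, ← Finset.sum_filter]
    congr 1
    ext i
    simp
  rw [jumpPoint_eq_sum_ite, jumpPoint_eq_sum_ite, Fin.sum_univ_succ]
  simp

theorem jumpPoint_smul (q : ℝ) (w : Fin k → ℝ) (h : Fin k) :
    jumpPoint (q • w) h = q * jumpPoint w h := by
  simp only [jumpPoint, Pi.smul_apply, smul_eq_mul, Finset.mul_sum]

theorem jumpPoint_pos (hv : ∀ h, 0 < v h) (h : Fin k) : 0 < jumpPoint v h :=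
  Finset.sum_pos (fun i _ => hv i) ⟨h, Finset.mem_Iic.2 le_rfl⟩

theorem lt_jumpPoint_cons (hs : x < s) (hv : ∀ h, 0 < v h) (h : Fin (k + 1)) :
    x < jumpPoint (Fin.cons s v : Fin (k + 1) → ℝ) h := by
  cases h using Fin.cases with
  | zero => rwa [jumpPoint_cons_zero]
  | succ h => linarith [jumpPoint_cons_succ s v h, jumpPoint_pos hv h]

/-- The point processes with gaps `v` and `v'` have the same points in `(-∞, x]`. -/
def AgreeUntil (x : ℝ) (v v' : Fin k → ℝ) : Prop :=
  ∀ h, ∀ e ≤ x, jumpPoint v h ≤ e ↔ jumpPoint v' h ≤ e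

theorem AgreeUntil.of_lt (hv : ∀ h, x < jumpPoint v h) (hv' : ∀ h, x < jumpPoint v' h) :
    AgreeUntil x v v' := fun h _ he =>
  iff_of_false (he.trans_lt (hv h)).not_ge (he.trans_lt (hv' h)).not_ge

theorem AgreeUntil.cons (hv : AgreeUntil (x - min s x) v v') :
    AgreeUntil x (Fin.cons s v : Fin (k + 1) → ℝ) (Fin.cons s v') := by
  intro h e he
  cases h using Fin.cases with
  | zero => rw [jumpPoint_cons_zero, jumpPoint_cons_zero]
  | succ h =>
    have hes : e - s ≤ x - min s x := by linarith [min_le_left s x]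
    simpa only [jumpPoint_cons_succ, le_sub_iff_add_le'] using hv h (e - s) hes

theorem cons_pos (hs : 0 < s) (hv : ∀ h, 0 < v h) (h : Fin (k + 1)) :
    0 < (Fin.cons s v : Fin (k + 1) → ℝ) h :=
  Fin.cases hs hv h

theorem ae_pos_pi_expMeasure {ι : Type*} [Fintype ι] {r : ℝ} (hr : 0 < r) :
    ∀ᵐ v ∂Measure.pi (fun _ : ι => expMeasure r), ∀ h, 0 < v h := by
  have := isProbabilityMeasure_expMeasure hr
  exact ae_pi_forall fun _ => ae_pos_expMeasure hr

theorem sq_lintegral_pi_expMeasure_le {a b : ℝ} (ha : 0 < a) (hb : 0 < b) (hx : 0 ≤ x)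
    {f : (Fin k → ℝ) → ℝ≥0∞} (hf : Measurable f)
    (hfx : ∀ v v', (∀ h, 0 < v h) → (∀ h, 0 < v' h) → AgreeUntil x v v' → f v = f v') :
    (∫⁻ v, f v ∂Measure.pi fun _ => expMeasure b) ^ 2 ≤
      ENNReal.ofReal (Real.exp ((b - a) ^ 2 / a * x)) *
        ∫⁻ v, f v ^ 2 ∂Measure.pi fun _ => expMeasure a := by
  have := isProbabilityMeasure_expMeasure ha
  have := isProbabilityMeasure_expMeasure hb
  induction k generalizing x with
  | zero =>
    have hf0 (v : Fin 0 → ℝ) : f v = f 0 := congrArg f (Subsingleton.elim v 0)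
    simp only [hf0, lintegral_const, measure_univ, mul_one]
    refine le_mul_of_one_le_left zero_le (ENNReal.one_le_ofReal.2 (Real.one_le_exp ?_))
    positivity
  | succ k ih =>
    have hcons : Measurable fun z : ℝ × (Fin k → ℝ) => (Fin.cons z.1 z.2 : Fin (k + 1) → ℝ) := by
      simpa only [Fin.insertNth_zero'] using
        (measurePreserving_insertNth (fun _ : Fin (k + 1) => expMeasure a) 0).measurable
    rw [lintegral_pi_insertNth _ 0 hf, lintegral_pi_insertNth _ 0 (hf.pow_const 2)]
    simp only [Fin.insertNth_zero']
    refine sq_lintegral_expMeasure_le ha hb hx (hf.comp hcons).lintegral_prod_right'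
      ((hf.pow_const 2).comp hcons).lintegral_prod_right'
      (K := ∫⁻ v, f (Fin.cons (x + 1) v) ∂Measure.pi fun _ => expMeasure b) ?_ ?_
    · intro s hs
      refine lintegral_congr_ae ?_
      filter_upwards [ae_pos_pi_expMeasure hb] with v hv
      exact hfx _ _ (cons_pos (hx.trans_lt hs) hv) (cons_pos (by linarith) hv)
        (.of_lt (lt_jumpPoint_cons hs hv) (lt_jumpPoint_cons (by linarith) hv))
    · intro s hs
      exact ih (sub_nonneg.2 (min_le_right s x)) (hf.comp (hcons.comp measurable_prodMk_left))
        fun v v' hv hv' hvv' => hfx _ _ (cons_pos hs hv) (cons_pos hs hv') hvv'.cons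

theorem bar_eq_of_agreeUntil {e : ℝ} (hv : AgreeUntil x v v') (he : e ≤ x) :
    bar v e = bar v' e := by
  simp only [bar, min_le_iff, hv _ e he]

theorem bar_smul {q e : ℝ} (w : Fin k → ℝ) (hq : 0 < q) (he : e < 1) (heq : e < q) :
    bar (q • w) e = bar w (e / q) := by
  have hdiv : ¬ 1 ≤ e / q := by rwa [one_le_div₀ hq, not_le]
  simp only [bar, min_le_iff, not_le.2 he, hdiv, false_or, jumpPoint_smul]
  simp only [le_div_iff₀' hq]

end PointProcess

section Schedules

variable {n : ℕ} (S : Schedule n) {s t x : ℝ} {p : Fin n → ℝ} {i j : Fin n}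

namespace Schedule

theorem elapsed_nonneg (ht : 0 ≤ t) (j : Fin n) : 0 ≤ S.elapsed t j := by
  simpa only [S.elapsed_zero] using S.mono 0 t j le_rfl ht

theorem elapsed_sub_le (hs : 0 ≤ s) (hst : s ≤ t) (j : Fin n) :
    S.elapsed t j - S.elapsed s j ≤ t - s :=
  (Finset.single_le_sum (f := fun j => S.elapsed t j - S.elapsed s j)
    (fun i _ => sub_nonneg.2 (S.mono s t i hs hst)) (Finset.mem_univ j)).trans (S.speed s t hs hst)

theorem elapsed_add_le (hij : i ≠ j) (ht : 0 ≤ t) : S.elapsed t i + S.elapsed t j ≤ t :=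
  calc S.elapsed t i + S.elapsed t j
      ≤ ∑ k, S.elapsed t k :=
        Finset.add_le_sum (fun k _ => S.elapsed_nonneg ht k) (Finset.mem_univ i)
          (Finset.mem_univ j) hij
    _ ≤ t := by simpa only [S.elapsed_zero, sub_zero] using S.speed 0 t le_rfl ht

theorem continuousOn_elapsed (j : Fin n) : ContinuousOn (fun t => S.elapsed t j) (Set.Ici 0) := by
  refine (LipschitzOnWith.of_le_add_mul 1 fun t ht s hs => ?_).continuousOn
  rw [NNReal.coe_one, one_mul, Real.dist_eq]
  rcases le_total s t with hst | hts
  · linarith [S.elapsed_sub_le hs hst j, le_abs_self (t - s)]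
  · linarith [S.mono t s j ht hts, abs_nonneg (t - s)]

theorem exists_max_elapsed_eq (ht : 0 ≤ t) (hx : 0 ≤ x) (hxj : x ≤ S.elapsed t j) :
    ∃ s, 0 ≤ s ∧ s ≤ t ∧ (∀ k, S.elapsed s k ≤ x) ∧ ∃ k, S.elapsed s k = x := by
  have huniv : (Finset.univ : Finset (Fin n)).Nonempty := ⟨j, Finset.mem_univ j⟩
  have hcont : ContinuousOn (fun s => Finset.univ.sup' huniv (S.elapsed s)) (Set.Icc 0 t) :=
    ContinuousOn.finset_sup'_apply huniv fun k _ =>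
      (S.continuousOn_elapsed k).mono Set.Icc_subset_Ici_self
  have hzero : Finset.univ.sup' huniv (S.elapsed 0) ≤ x :=
    Finset.sup'_le _ _ fun k _ => (S.elapsed_zero k).trans_le hx
  obtain ⟨s, ⟨hs, hst⟩, hmax⟩ := intermediate_value_Icc ht hcont
    ⟨hzero, Finset.le_sup'_of_le _ (Finset.mem_univ j) hxj⟩
  obtain ⟨k, -, hk⟩ := Finset.exists_mem_eq_sup' huniv (S.elapsed s)
  exact ⟨s, hs, hst, fun k => (Finset.le_sup' _ (Finset.mem_univ k)).trans_eq hmax,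
    k, hk.symm.trans hmax⟩

/-- Job `i` is among the first jobs to receive `x` units of processing: as soon as any job has
received `x` units, so has job `i`. -/
def IsLeader (x : ℝ) (i : Fin n) : Prop :=
  ∀ t, 0 ≤ t → ∀ j, x ≤ S.elapsed t j → x ≤ S.elapsed t i

theorem exists_isLeader [Nonempty (Fin n)] (x : ℝ) : ∃ i, S.IsLeader x i := by
  by_contra! h
  simp only [IsLeader, not_forall, not_le] at h
  choose t ht j hj hlt using h
  obtain ⟨i, hi⟩ := Finite.exists_min t
  exact ((hj i).trans (S.mono _ _ _ (ht i) (hi (j i)))).not_gt (hlt (j i))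

theorem isLeader_iff_forall_rat :
    S.IsLeader x i ↔ ∀ t : ℚ, 0 ≤ (t : ℝ) → ∀ j, x ≤ S.elapsed t j → x ≤ S.elapsed t i := by
  refine ⟨fun h t => h t, fun h t ht j hj => ?_⟩
  by_contra! hi
  obtain ⟨s, hts, hs⟩ := exists_rat_btwn (show t < t + (x - S.elapsed t i) by linarith)
  have hsi := h s (by linarith) j (hj.trans (S.mono t s j ht hts.le))
  linarith [S.elapsed_sub_le ht hts.le i]

theorem completionTime_le (ht : 0 ≤ t) (hj : p j ≤ S.elapsed t j) :
    S.completionTime p j ≤ ENNReal.ofReal t :=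
  iInf₂_le t ⟨ht, hj⟩

theorem ofReal_le_totalCompletionTime (hij : i ≠ j) {y : ℝ}
    (hy : ∀ s t, 0 ≤ s → 0 ≤ t → p i ≤ S.elapsed s i → p j ≤ S.elapsed t j → y ≤ s + t) :
    ENNReal.ofReal y ≤ S.totalCompletionTime p := by
  have hpair : ENNReal.ofReal y ≤ S.completionTime p i + S.completionTime p j := by
    simp only [completionTime, ENNReal.iInf_add, ENNReal.add_iInf, le_iInf_iff]
    rintro t ⟨ht, hj⟩ s ⟨hs, hi⟩
    rw [← ENNReal.ofReal_add hs ht]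
    exact ENNReal.ofReal_le_ofReal (hy s t hs ht hi hj)
  exact hpair.trans
    (Finset.add_le_sum (fun _ _ => zero_le) (Finset.mem_univ i) (Finset.mem_univ j) hij)

theorem le_totalCompletionTime_of_isLeader (hij : i ≠ j) (hxj : x ≤ p j) (hxi : p j + x ≤ p i)
    (hi : S.IsLeader x i) : ENNReal.ofReal (2 * p j + p i + x) ≤ S.totalCompletionTime p := by
  refine S.ofReal_le_totalCompletionTime hij fun s t hs ht hsi htj => ?_
  have hti := hi t ht j (hxj.trans htj)
  rcases le_total t s with hts | hst
  · linarith [S.elapsed_add_le hij hs, S.elapsed_add_le hij ht, S.mono t s j ht hts]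
  · linarith [S.elapsed_add_le hij hs, S.elapsed_add_le hij ht, S.mono s t i hs hst,
      S.elapsed_nonneg hs j]

theorem le_totalCompletionTime (hij : i ≠ j) (hpj : 0 ≤ p j) (hp : p j ≤ p i) :
    ENNReal.ofReal (2 * p j + p i) ≤ S.totalCompletionTime p := by
  simpa only [add_zero] using S.le_totalCompletionTime_of_isLeader hij hpj (by rwa [add_zero])
    fun t ht _ _ => S.elapsed_nonneg ht i

/-- The schedule of two jobs that processes job `j` during the first `c` units of time and the
other job afterwards. -/
@[simps]
def sequential (j : Fin 2) (c : ℝ) (hc : 0 ≤ c) : Schedule 2 where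
  elapsed t k := if k = j then min t c else max 0 (t - c)
  elapsed_zero k := by split_ifs <;> simp [hc]
  mono s t k _ hst := by split_ifs <;> gcongr
  speed s t _ _ := by
    have hsum (r : ℝ) : ∑ k, (if k = j then min r c else max 0 (r - c)) = r := by
      have hsplit : min r c + max 0 (r - c) = r := by
        rcases le_total r c with h | h <;> simp [h]
      fin_cases j <;> simp [Fin.sum_univ_two, hsplit, add_comm (max _ _)]
    rw [Finset.sum_sub_distrib, hsum, hsum]

end Schedule

theorem opt_le_two_mul_add {i j : Fin 2} (hij : i ≠ j) {p : Fin 2 → ℝ} (hp : ∀ k, 0 ≤ p k) :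
    opt p ≤ ENNReal.ofReal (2 * p j + p i) := by
  set S := Schedule.sequential j (p j) (hp j)
  have hj : S.completionTime p j ≤ ENNReal.ofReal (p j) :=
    S.completionTime_le (hp j) (by simp [S])
  have hi : S.completionTime p i ≤ ENNReal.ofReal (p j + p i) :=
    S.completionTime_le (add_nonneg (hp j) (hp i)) (by simp [S, hij])
  have huniv : (Finset.univ : Finset (Fin 2)) = {j, i} := by
    symm
    rw [← Finset.card_eq_iff_eq_univ, Finset.card_pair hij.symm, Fintype.card_fin]
  calc opt p ≤ S.totalCompletionTime p := iInf_le _ S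
    _ = S.completionTime p j + S.completionTime p i := by
        rw [Schedule.totalCompletionTime, huniv, Finset.sum_pair hij.symm]
    _ ≤ ENNReal.ofReal (p j) + ENNReal.ofReal (p j + p i) := add_le_add hj hi
    _ = ENNReal.ofReal (2 * p j + p i) := by
        rw [← ENNReal.ofReal_add (hp j) (add_nonneg (hp j) (hp i))]
        ring_nf

end Schedules

section Displays

variable {U : Type*} {n g : ℕ} {x : ℝ}

/-- The event `L u X`, about the seed `u` and the displayed progress `X`, is determined by what is
displayed of each job during its first `x` units of processing. -/
def IsObservableUntil (g : ℕ) (x : ℝ) (L : U → (Fin n → ℝ → ℝ) → Prop) : Prop :=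
  ∀ u, ∀ X ∈ displays n g, ∀ Y ∈ displays n g, (∀ j, ∀ e ≤ x, X j e = Y j e) → (L u X ↔ L u Y)

/-- The event `L`, in terms of the seed and the gaps, for jobs with processing times `p`. -/
def displayEvent (g : ℕ) (L : U → (Fin n → ℝ → ℝ) → Prop) (p : Fin n → ℝ) :
    Set (U × (Fin n → Fin g → ℝ)) :=
  {z | L z.1 (display p z.2)}

variable [MeasurableSpace U]

/-- In its schedule, the algorithm makes job `i` one of the first jobs to receive `x` units of
processing. -/
def Algorithm.MakesLeader (A : Algorithm g U) (x : ℝ) (i : Fin n) (u : U) (X : Fin n → ℝ → ℝ) :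
    Prop :=
  (A.run n u X).IsLeader x i

theorem Algorithm.isObservableUntil_makesLeader (A : Algorithm g U) (hx : 0 ≤ x) (i : Fin n) :
    IsObservableUntil g x (A.MakesLeader x i) := by
  suffices h : ∀ u, ∀ X ∈ displays n g, ∀ Y ∈ displays n g, (∀ j, ∀ e ≤ x, X j e = Y j e) →
      A.MakesLeader x i u X → A.MakesLeader x i u Y from fun u X hX Y hY hXY =>
    ⟨h u X hX Y hY hXY, h u Y hY X hX fun j e he => (hXY j e he).symm⟩
  intro u X hX Y hY hXY hlead t ht j hj
  obtain ⟨s, hs, hst, hmax, k, hk⟩ := (A.run n u Y).exists_max_elapsed_eq ht hx hj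
  have heq : (A.run n u Y).elapsed s = (A.run n u X).elapsed s :=
    A.online n u Y hY X hX s hs fun j e he => (hXY j e (he.2.trans (hmax j))).symm
  calc x ≤ (A.run n u X).elapsed s i := hlead s hs k (by rw [← heq, hk])
    _ = (A.run n u Y).elapsed s i := by rw [heq]
    _ ≤ (A.run n u Y).elapsed t i := (A.run n u Y).mono s t i hs hst

theorem Algorithm.measurableSet_makesLeader (A : Algorithm g U) (x : ℝ) (i : Fin n)
    {p : Fin n → ℝ} (hp : ∀ j, 0 < p j) :
    MeasurableSet (displayEvent g (A.MakesLeader x i) p) := by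
  simp only [displayEvent, MakesLeader, Schedule.isLeader_iff_forall_rat, Set.ofPred_forall]
  refine MeasurableSet.iInter fun t => .iInter fun ht => .iInter fun j => ?_
  exact (measurableSet_le measurable_const (A.measurable_run n p hp t j ht)).imp
    (measurableSet_le measurable_const (A.measurable_run n p hp t i ht))

theorem isProbabilityMeasure_barLaw (n : ℕ) (hg : 0 < g) : IsProbabilityMeasure (barLaw n g) := by
  have := isProbabilityMeasure_expMeasure (Nat.cast_pos.2 hg : (0 : ℝ) < g)
  unfold barLaw
  infer_instance

theorem ae_pos_barLaw (hg : 0 < g) : ∀ᵐ w ∂barLaw n g, ∀ j h, 0 < w j h := by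
  have := isProbabilityMeasure_expMeasure (Nat.cast_pos.2 hg : (0 : ℝ) < g)
  exact ae_pi_forall fun _ => ae_pos_pi_expMeasure (Nat.cast_pos.2 hg)

variable {ν : Measure U} {L : U → (Fin (n + 1) → ℝ → ℝ) → Prop} {p p' : Fin (n + 1) → ℝ}
  {i : Fin (n + 1)} {s s' : Fin g → ℝ}

theorem measurePreserving_insertNth_barLaw [SFinite ν] (hg : 0 < g) (i : Fin (n + 1)) :
    MeasurePreserving
      (fun z : (Fin g → ℝ) × U × (Fin n → Fin g → ℝ) =>
        (z.2.1, (i.insertNth z.1 z.2.2 : Fin (n + 1) → Fin g → ℝ)))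
      ((Measure.pi fun _ => expMeasure g).prod (ν.prod (barLaw n g)))
      (ν.prod (barLaw (n + 1) g)) := by
  have := isProbabilityMeasure_expMeasure (Nat.cast_pos.2 hg : (0 : ℝ) < g)
  exact measurePreserving_prodMk_insertNth (fun _ => Measure.pi fun _ => expMeasure g) i ν

/-- The conditional probability of the event `L`, for jobs with processing times `p`, given that the
progress bar of job `i` has gaps `s`. -/
noncomputable def probGivenGaps (ν : Measure U) (L : U → (Fin (n + 1) → ℝ → ℝ) → Prop)
    (p : Fin (n + 1) → ℝ) (i : Fin (n + 1)) (s : Fin g → ℝ) : ℝ≥0∞ :=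
  ν.prod (barLaw n g) {y | L y.1 (display p (i.insertNth s y.2))}

theorem measurable_probGivenGaps [SFinite ν] (hg : 0 < g)
    (hE : MeasurableSet (displayEvent g L p)) :
    Measurable (probGivenGaps (g := g) ν L p i) := by
  have := isProbabilityMeasure_barLaw n hg
  exact measurable_measure_prodMk_left
    ((measurePreserving_insertNth_barLaw (ν := ν) hg i).measurable hE)

theorem lintegral_probGivenGaps [SFinite ν] (hg : 0 < g)
    (hE : MeasurableSet (displayEvent g L p)) (i : Fin (n + 1)) :
    ∫⁻ s, probGivenGaps ν L p i s ∂(Measure.pi fun _ : Fin g => expMeasure g) =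
      ν.prod (barLaw (n + 1) g) (displayEvent g L p) := by
  have := isProbabilityMeasure_barLaw n hg
  have hins := measurePreserving_insertNth_barLaw (ν := ν) hg i
  rw [← hins.measure_preimage hE.nullMeasurableSet, Measure.prod_apply (hins.measurable hE)]
  rfl

theorem probGivenGaps_le_one [IsProbabilityMeasure ν] (hg : 0 < g) :
    probGivenGaps ν L p i s ≤ 1 := by
  have := isProbabilityMeasure_barLaw n hg
  exact prob_le_one

theorem forall_pos_update {ι : Type*} [DecidableEq ι] {p : ι → ℝ} (hp : ∀ k, 0 < p k) {i : ι}
    {q : ℝ} (hq : 0 < q) : ∀ k, 0 < Function.update p i q k :=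
  (Function.forall_update_iff p fun _ y => 0 < y).2 ⟨hq, fun k _ => hp k⟩

theorem insertNth_mem_displays (hp : ∀ k, 0 < p k) (hs : ∀ h, 0 < s h) {w : Fin n → Fin g → ℝ}
    (hw : ∀ k h, 0 < w k h) : display p (i.insertNth s w) ∈ displays (n + 1) g :=
  ⟨p, _, hp, (Fin.forall_iff_succAbove i).2
    ⟨by simpa only [Fin.insertNth_apply_same] using hs,
      by simpa only [Fin.insertNth_apply_succAbove] using hw⟩, rfl⟩

theorem IsObservableUntil.probGivenGaps_congr (hg : 0 < g)
    (hL : IsObservableUntil g x L) (hp : ∀ k, 0 < p k) (hp' : ∀ k, 0 < p' k)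
    (hpp' : ∀ k ≠ i, p k = p' k) (hs : ∀ h, 0 < s h) (hs' : ∀ h, 0 < s' h)
    (hbar : ∀ e ≤ x, bar s (e / p i) = bar s' (e / p' i)) :
    probGivenGaps ν L p i s = probGivenGaps ν L p' i s' := by
  have := isProbabilityMeasure_barLaw n hg
  refine measure_congr ?_
  filter_upwards [Measure.quasiMeasurePreserving_snd.ae (ae_pos_barLaw hg)] with y hy
  have hdisplay : ∀ k, ∀ e ≤ x,
      display p (i.insertNth s y.2) k e = display p' (i.insertNth s' y.2) k e := by
    refine (Fin.forall_iff_succAbove i).2 ⟨fun e he => ?_, fun k e _ => ?_⟩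
    · simpa only [display, Fin.insertNth_apply_same] using hbar e he
    · simp only [display, Fin.insertNth_apply_succAbove, hpp' _ (i.succAbove_ne k)]
  exact propext (hL y.1 _ (insertNth_mem_displays hp hs hy) _ (insertNth_mem_displays hp' hs' hy)
    hdisplay)

theorem IsObservableUntil.probGivenGaps_smul (hg : 0 < g)
    (hL : IsObservableUntil g x L) (hp : ∀ k, 0 < p k) {q : ℝ} (hq : 0 < q) (hxp : x < p i)
    (hxq : x < q) (hs : ∀ h, 0 < s h) :
    probGivenGaps ν L p i ((q / p i) • s) = probGivenGaps ν L (Function.update p i q) i s := by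
  have hr : 0 < q / p i := div_pos hq (hp i)
  refine hL.probGivenGaps_congr hg hp (forall_pos_update hp hq)
    (fun k hk => (Function.update_of_ne hk _ _).symm) (fun h => mul_pos hr (hs h)) hs
    fun e he => ?_
  have he1 : e / p i < 1 := (div_lt_one (hp i)).2 (he.trans_lt hxp)
  have her : e / p i < q / p i := (div_lt_div_iff_of_pos_right (hp i)).2 (he.trans_lt hxq)
  rw [Function.update_self, bar_smul s hr he1 her, div_div_div_cancel_right₀ (hp i).ne']

theorem IsObservableUntil.lintegral_sq_probGivenGaps_le [IsProbabilityMeasure ν] (hg : 0 < g)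
    (hL : IsObservableUntil g x L) (hp : ∀ k, 0 < p k) {q : ℝ} (hq : 0 < q) (hxp : x < p i)
    (hxq : x < q) (hE : MeasurableSet (displayEvent g L p))
    (hE' : MeasurableSet (displayEvent g L (Function.update p i q))) :
    ∫⁻ s, probGivenGaps ν L p i s ^ 2 ∂(Measure.pi fun _ : Fin g => expMeasure (g / (q / p i))) ≤
      ν.prod (barLaw (n + 1) g) (displayEvent g L (Function.update p i q)) := by
  have hg0 : (0 : ℝ) < g := Nat.cast_pos.2 hg
  calc ∫⁻ s, probGivenGaps ν L p i s ^ 2 ∂(Measure.pi fun _ : Fin g => expMeasure (g / (q / p i)))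
      ≤ ∫⁻ s, probGivenGaps ν L p i s ∂(Measure.pi fun _ : Fin g => expMeasure (g / (q / p i))) :=
        lintegral_mono fun s => pow_le_of_le_one zero_le (probGivenGaps_le_one hg) two_ne_zero
    _ = ∫⁻ s, probGivenGaps ν L p i ((q / p i) • s) ∂(Measure.pi fun _ : Fin g => expMeasure g) :=
        ((measurePreserving_smul_pi_expMeasure hg0 (div_pos hq (hp i))).lintegral_comp
          (measurable_probGivenGaps hg hE)).symm
    _ = ∫⁻ s, probGivenGaps ν L (Function.update p i q) i s
          ∂(Measure.pi fun _ : Fin g => expMeasure g) := by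
        refine lintegral_congr_ae ?_
        filter_upwards [ae_pos_pi_expMeasure hg0] with s hs
        exact hL.probGivenGaps_smul hg hp hq hxp hxq hs
    _ = ν.prod (barLaw (n + 1) g) (displayEvent g L (Function.update p i q)) :=
        lintegral_probGivenGaps hg hE' i

theorem IsObservableUntil.sq_measureReal_le [IsProbabilityMeasure ν] (hg : 0 < g)
    (hL : IsObservableUntil g x L) (hp : ∀ k, 0 < p k) {q : ℝ} (hx : 0 ≤ x) (hxp : x < p i)
    (hxq : x < q) (hE : MeasurableSet (displayEvent g L p))
    (hE' : MeasurableSet (displayEvent g L (Function.update p i q))) :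
    (ν.prod (barLaw (n + 1) g)).real (displayEvent g L p) ^ 2 ≤
      Real.exp (g * (q - p i) ^ 2 / (p i ^ 2 * q) * x) *
        (ν.prod (barLaw (n + 1) g)).real (displayEvent g L (Function.update p i q)) := by
  have hg0 : (0 : ℝ) < g := Nat.cast_pos.2 hg
  have hpi : 0 < p i := hp i
  have hq : 0 < q := hx.trans_lt hxq
  have := isProbabilityMeasure_barLaw (n + 1) hg
  have hchisq := sq_lintegral_pi_expMeasure_le (div_pos hg0 (div_pos hq hpi)) hg0
    (div_nonneg hx hpi.le) (measurable_probGivenGaps (ν := ν) (i := i) hg hE)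
    fun s s' hs hs' hss' => hL.probGivenGaps_congr hg hp hp (fun _ _ => rfl) hs hs' fun e he =>
      bar_eq_of_agreeUntil hss' (by gcongr)
  have hexponent : (g - g / (q / p i)) ^ 2 / (g / (q / p i)) * (x / p i) =
      g * (q - p i) ^ 2 / (p i ^ 2 * q) * x := by
    field_simp
  rw [lintegral_probGivenGaps hg hE, hexponent] at hchisq
  rw [← ENNReal.ofReal_le_ofReal_iff (by positivity), ENNReal.ofReal_mul (by positivity),
    ENNReal.ofReal_pow measureReal_nonneg, ofReal_measureReal, ofReal_measureReal]
  exact hchisq.trans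
    (mul_le_mul_right (hL.lintegral_sq_probGivenGaps_le hg hp hq hxp hxq hE hE') _)

end Displays

section LowerBound

variable {U : Type*} [MeasurableSpace U] {g n : ℕ} {x ε : ℝ} (A : Algorithm g U) (ν : Measure U)
  [IsProbabilityMeasure ν]

theorem Algorithm.exists_inv_le_measureReal_makesLeader [NeZero n] (hg : 0 < g) (x : ℝ)
    (p : Fin n → ℝ) :
    ∃ i, (n : ℝ)⁻¹ ≤ (ν.prod (barLaw n g)).real (displayEvent g (A.MakesLeader x i) p) := by
  have := isProbabilityMeasure_barLaw n hg
  have hcover : ⋃ i, displayEvent g (A.MakesLeader x i) p = Set.univ :=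
    Set.eq_univ_of_forall fun z => Set.mem_iUnion.2
      ((A.run n z.1 (display p z.2)).exists_isLeader x)
  simpa only [Fintype.card_fin] using
    exists_inv_card_le_measureReal (ν.prod (barLaw n g)) hcover

theorem Algorithm.le_expectedCost (hg : 0 < g) {p : Fin n → ℝ} (hp : ∀ k, 0 < p k) {i j : Fin n}
    (hij : i ≠ j) (hx : 0 ≤ x) (hxj : x ≤ p j) (hxi : p j + x ≤ p i) :
    ENNReal.ofReal (2 * p j + p i +
        x * (ν.prod (barLaw n g)).real (displayEvent g (A.MakesLeader x i) p)) ≤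
      A.expectedCost ν p := by
  have := isProbabilityMeasure_barLaw n hg
  have hpi := hp i
  have hpj := hp j
  have hE := A.measurableSet_makesLeader x i hp
  calc ENNReal.ofReal (2 * p j + p i +
          x * (ν.prod (barLaw n g)).real (displayEvent g (A.MakesLeader x i) p))
      = ∫⁻ z, ENNReal.ofReal (2 * p j + p i) +
          ENNReal.ofReal x * (displayEvent g (A.MakesLeader x i) p).indicator 1 z
            ∂ν.prod (barLaw n g) := by
        rw [lintegral_add_left measurable_const, lintegral_const, measure_univ, mul_one,
          lintegral_const_mul _ (measurable_one.indicator hE), lintegral_indicator_one hE,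
          ENNReal.ofReal_add (by positivity) (by positivity), ENNReal.ofReal_mul hx,
          ofReal_measureReal]
    _ ≤ A.expectedCost ν p := lintegral_mono fun z => ?_
  by_cases hz : z ∈ displayEvent g (A.MakesLeader x i) p
  · rw [Set.indicator_of_mem hz, Pi.one_apply, mul_one, ← ENNReal.ofReal_add (by positivity) hx]
    exact Schedule.le_totalCompletionTime_of_isLeader _ hij hxj hxi hz
  · rw [Set.indicator_of_notMem hz, mul_zero, add_zero]
    exact Schedule.le_totalCompletionTime _ hij hpj.le (by linarith)

theorem Algorithm.exists_exp_le_measureReal_makesLeader (hg : 0 < g) (hε : 0 < ε) (hε1 : ε < 1) :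
    ∃ i : Fin 2, 1 / 4 * Real.exp (-(g * ε ^ 3 / (1 + ε))) ≤ (ν.prod (barLaw 2 g)).real
      (displayEvent g (A.MakesLeader ε i) (Function.update 1 i (1 + ε))) := by
  have hone : ∀ k : Fin 2, (0 : ℝ) < (1 : Fin 2 → ℝ) k := fun _ => one_pos
  obtain ⟨i, hhalf⟩ := A.exists_inv_le_measureReal_makesLeader ν hg ε (1 : Fin 2 → ℝ)
  have hcompare := (A.isObservableUntil_makesLeader hε.le i).sq_measureReal_le (ν := ν) (i := i) hg
    hone hε.le hε1 (by linarith : ε < 1 + ε) (A.measurableSet_makesLeader ε i hone)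
    (A.measurableSet_makesLeader ε i (forall_pos_update hone (by positivity)))
  have hexponent : g * (1 + ε - 1) ^ 2 / (1 ^ 2 * (1 + ε)) * ε = g * ε ^ 3 / (1 + ε) := by
    ring
  rw [Pi.one_apply, hexponent] at hcompare
  refine ⟨i, ?_⟩
  rw [Real.exp_neg, ← div_eq_mul_inv, div_le_iff₀' (Real.exp_pos _)]
  refine le_trans ?_ hcompare
  calc (1 / 4 : ℝ) = ((2 : ℕ) : ℝ)⁻¹ ^ 2 := by norm_num
    _ ≤ _ := by gcongr

theorem Algorithm.le_competitiveRatio (hg : 0 < g) (hε : 0 < ε) (hε1 : ε < 1) :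
    ENNReal.ofReal (1 + ε / (4 * (3 + ε)) * Real.exp (-(g * ε ^ 3 / (1 + ε)))) ≤
      A.competitiveRatio ν := by
  obtain ⟨i, hi⟩ := A.exists_exp_le_measureReal_makesLeader ν hg hε hε1
  obtain ⟨j, hji⟩ := exists_ne i
  set P := (ν.prod (barLaw 2 g)).real
    (displayEvent g (A.MakesLeader ε i) (Function.update 1 i (1 + ε)))
  set p : Fin 2 → ℝ := Function.update 1 i (1 + ε)
  have hpi : p i = 1 + ε := Function.update_self ..
  have hpj : p j = 1 := Function.update_of_ne hji ..
  have hp0 : ∀ k, 0 < p k := forall_pos_update (fun _ => one_pos) (by positivity)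
  have hcost : ENNReal.ofReal (3 + ε + ε * P) ≤ A.expectedCost ν p := by
    convert A.le_expectedCost ν hg hp0 hji.symm hε.le (by rw [hpj]; exact hε1.le)
      (by rw [hpi, hpj]) using 3
    rw [hpi, hpj]
    ring
  have hopt : opt p ≤ ENNReal.ofReal (3 + ε) := by
    convert opt_le_two_mul_add hji.symm fun k => (hp0 k).le using 2
    rw [hpi, hpj]
    ring
  calc ENNReal.ofReal (1 + ε / (4 * (3 + ε)) * Real.exp (-(g * ε ^ 3 / (1 + ε))))
      = ENNReal.ofReal
          ((3 + ε + ε * (1 / 4 * Real.exp (-(g * ε ^ 3 / (1 + ε))))) / (3 + ε)) := by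
        congr 1
        field_simp
    _ ≤ ENNReal.ofReal ((3 + ε + ε * P) / (3 + ε)) := by gcongr
    _ = ENNReal.ofReal (3 + ε + ε * P) / ENNReal.ofReal (3 + ε) :=
        ENNReal.ofReal_div_of_pos (by positivity)
    _ ≤ A.expectedCost ν p / opt p := ENNReal.div_le_div hcost hopt
    _ ≤ A.competitiveRatio ν :=
        le_iSup_of_le 2 (le_iSup₂_of_le p ⟨two_pos, hp0⟩ le_rfl)

theorem Algorithm.one_add_div_le_competitiveRatio (hg : 0 < g) (hε : 0 < ε)
    (hcube : g * ε ^ 3 ≤ 1 / 8) : ENNReal.ofReal (1 + ε / 16) ≤ A.competitiveRatio ν := by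
  have hε1 : ε ≤ 1 / 2 := by
    refine (pow_le_pow_iff_left₀ hε.le (by norm_num) three_ne_zero).1 ?_
    calc ε ^ 3 ≤ g * ε ^ 3 := le_mul_of_one_le_left (by positivity) (Nat.one_le_cast.2 hg)
      _ ≤ (1 / 2) ^ 3 := by linarith
  have hexp : 7 / 8 ≤ Real.exp (-(g * ε ^ 3 / (1 + ε))) := by
    have hexponent : g * ε ^ 3 / (1 + ε) ≤ 1 / 8 :=
      (div_le_self (by positivity) (by linarith)).trans hcube
    linarith [Real.add_one_le_exp (-(g * ε ^ 3 / (1 + ε)))]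
  refine le_trans (ENNReal.ofReal_le_ofReal ?_) (A.le_competitiveRatio ν hg hε (by linarith))
  calc 1 + ε / 16 = 1 + ε / (4 * (3 + 1 / 2)) * (7 / 8) := by ring
    _ ≤ 1 + ε / (4 * (3 + ε)) * Real.exp (-(g * ε ^ 3 / (1 + ε))) := by gcongr

end LowerBound

end ProgressBar

theorem mainTheorem3 (g : ℕ) (hg : 1 ≤ g) {U : Type*} [MeasurableSpace U]
    (ν : Measure U) [IsProbabilityMeasure ν] (A : ProgressBar.Algorithm g U) :
    ENNReal.ofReal (1 + 1 / 36 * (g : ℝ) ^ (-(1 / 3) : ℝ)) ≤ A.competitiveRatio ν := by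
  have hg0 : (0 : ℝ) < g := Nat.cast_pos.2 hg
  set δ : ℝ := (g : ℝ) ^ (-(1 / 3) : ℝ)
  have hδ : 0 < δ := Real.rpow_pos_of_pos hg0 _
  have hδ3 : δ ^ 3 = (g : ℝ)⁻¹ := by
    rw [← Real.rpow_natCast, ← Real.rpow_mul hg0.le, ← Real.rpow_neg_one]
    norm_num
  have hcube : g * (δ / 2) ^ 3 = 1 / 8 := by
    rw [div_pow, hδ3]
    field_simp
    norm_num
  calc ENNReal.ofReal (1 + 1 / 36 * δ)
      ≤ ENNReal.ofReal (1 + δ / 2 / 16) := ENNReal.ofReal_le_ofReal (by linarith)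
    _ ≤ A.competitiveRatio ν := A.one_add_div_le_competitiveRatio ν hg (half_pos hδ) hcube.le
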